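/- Let $K\ge 0$, $J=K+4$, and let $\xi_0<\xi_1<\dots<\xi_{K+1}$ be knots with an augmented sequence $\tau_1\le\dots\le\tau_{K+8}$ as usual for cubic (order 4) B-splines: $\tau_1\le\dots\le\tau_4\le\xi_0$, $\tau_{4+k}=\xi_k$ for $1\le k\le K$, and $\xi_{K+1}\le\tau_{K+5}\le\dots\le\tau_{K+8}$. Let $B_1,\dots,B_J$ be the cubic B-spline basis functions for $\tau$ given by the Cox–de Boor recursion (with the usual conventions that terms with zero denominator are $0$ and that the last nondegenerate knot interval is closed on the right), let $x_1,\dots,x_n\in\mathbb R$, and let $\mathbf B=(B_j(x_i))\in\mathbb R^{n\times J}$. Assume that $\mathbf B$ has full column rank $J$. Fix $\alpha\in\{1,-1\}$. For $y\in\mathbb R^n$ let $\hat\gamma(y)$ be the solution of $$\min_{\gamma\in\mathbb R^J}\ (y-\mathbf B\gamma)^T(y-\mathbf B\gamma)\quad\text{subject to}\quad \alpha(\gamma_j-\gamma_{j+1})\le 0,\ j=1,\dots,J-1,$$ which exists and is unique, and let $\hat y(y)=\mathbf B\hat\gamma(y)$ be the monotone cubic B-spline fit. Let $U_y$ be the number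 of distinct values among the coefficients $\hat\gamma_1(y),\dots,\hat\gamma_J(y)$. Let $Y_i=f_i+\varepsilon_i$, $i=1,\dots,n$, where $f\in\mathbb R^n$ is arbitrary and $\varepsilon_1,\dots,\varepsilon_n$ are independent $N(0,\sigma^2)$ variables with $\sigma>0$. Then the components of $\hat y(Y)$ are square integrable, $\hat y$ is almost surely differentiable at $Y$, its divergence $\sum_i\partial\hat y_i/\partial y_i$ at $Y$ and the variable $U_Y$ are integrable, and the degrees of freedom of the fit are $$\mathrm{df}:=\frac1{\sigma^2}\sum_{i=1}^n\operatorname{Cov}\bigl(\hat y_i(Y),Y_i\bigr)=\mathbb E\Bigl[\sum_{i=1}^n\frac{\partial\hat y_i}{\partial y_i}(Y)\Bigr]=\mathbb E[U_Y].$$ -/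

import Mathlib

open MeasureTheory ProbabilityTheory
open scoped NNReal Matrix

namespace MonoSpline

noncomputable section

/-- `τ 0, …, τ (K + 2 * M - 1)` is an augmented knot sequence, for splines of order `M`, of the
knots `ξ 0 < ξ 1 < ⋯ < ξ (K + 1)`, of which `ξ 0` and `ξ (K + 1)` are the boundary knots. Indices
start at `0`; values of `τ` from index `K + 2 * M` on play no role. -/
structure IsAugmentedKnots (K M : ℕ) (ξ : Fin (K + 2) → ℝ) (τ : ℕ → ℝ) : Prop where
  strictMono : StrictMono ξ
  left_le_succ : ∀ i, i + 1 < M → τ i ≤ τ (i + 1)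
  left_le : ∀ i, i < M → τ i ≤ ξ 0
  interior : ∀ k : Fin K, τ (M + k) = ξ k.castSucc.succ
  right_ge : ∀ i, K + M ≤ i → i < K + 2 * M → ξ (Fin.last (K + 1)) ≤ τ i
  right_le_succ : ∀ i, K + M ≤ i → i + 1 < K + 2 * M → τ i ≤ τ (i + 1)

/-- `bspline N τ m i` is the `i`-th B-spline basis function of order `m` (degree `m - 1`) for the
knots `τ 0 ≤ ⋯ ≤ τ N`, by the Cox-de Boor recursion, where a term with a zero denominator is
zero (as it is for division in Lean). Order-one basis functions are indicators of
`[τ i, τ (i + 1))`, except that the last nondegenerate interval also contains its right end `τ N`,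
which is the usual convention under which the basis functions add up to one on the whole closed
interval between the boundary knots also when the last knots coincide. -/
def bspline (N : ℕ) (τ : ℕ → ℝ) : ℕ → ℕ → ℝ → ℝ
  | 0, _, _ => 0
  | 1, i, x =>
      open Classical in
      if (τ i ≤ x ∧ x < τ (i + 1)) ∨ (τ i < τ (i + 1) ∧ τ (i + 1) = τ N ∧ x = τ N) then 1 else 0
  | m + 2, i, x =>
      (x - τ i) / (τ (i + m + 1) - τ i) * bspline N τ (m + 1) i x
        + (τ (i + m + 2) - x) / (τ (i + m + 2) - τ (i + 1)) * bspline N τ (m + 1) (i + 1) x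

/-- The `n × (K + 4)` matrix of the cubic (order four) B-spline basis functions at the design
points. -/
def cubicBasisMatrix (K : ℕ) (τ : ℕ → ℝ) {n : ℕ} (x : Fin n → ℝ) :
    Matrix (Fin n) (Fin (K + 4)) ℝ :=
  Matrix.of fun i j => bspline (K + 7) τ 4 j (x i)

/-- The `m × (m + 1)` matrix with `(A γ) i = γ i - γ (i + 1)`. -/
def diffMatrix (m : ℕ) : Matrix (Fin m) (Fin (m + 1)) ℝ :=
  Matrix.of fun i j => if j = i.castSucc then 1 else if j = i.succ then -1 else 0

/-- `γ` solves: minimize `(y - B γ)ᵀ (y - B γ)` subject to `α A γ ≤ 0`, that is, the coefficients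
are nondecreasing for `α = 1` and nonincreasing for `α = -1`. -/
def IsMonotoneLSSolution {n m : ℕ} (α : ℝ) (B : Matrix (Fin n) (Fin (m + 1)) ℝ)
    (y : Fin n → ℝ) (γ : Fin (m + 1) → ℝ) : Prop :=
  α • (diffMatrix m *ᵥ γ) ≤ 0 ∧
    ∀ β : Fin (m + 1) → ℝ, α • (diffMatrix m *ᵥ β) ≤ 0 →
      (y - B *ᵥ γ) ⬝ᵥ (y - B *ᵥ γ) ≤ (y - B *ᵥ β) ⬝ᵥ (y - B *ᵥ β)

/-- The number of distinct values among the coefficients. -/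
def numDistinct {J : ℕ} (γ : Fin J → ℝ) : ℕ := (Set.range γ).ncard

/-- The divergence `∑ i, ∂ F i / ∂ y i` of a map at a point (meant where `F` is differentiable). -/
def divergence {n : ℕ} (F : (Fin n → ℝ) → (Fin n → ℝ)) (y : Fin n → ℝ) : ℝ :=
  ∑ i, fderiv ℝ F y (Pi.single i 1) i

/-- The degrees of freedom `σ⁻² ∑ i, Cov (F i (Y), Y i)` of the fit `F (Y)` to the data `Y` with
noise variance `σ ^ 2`. -/
def degreesOfFreedom {Ω : Type*} [MeasurableSpace Ω] (P : Measure Ω) (σ : ℝ) {n : ℕ}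
    (F : (Fin n → ℝ) → (Fin n → ℝ)) (Y : Ω → Fin n → ℝ) : ℝ :=
  (1 / σ ^ 2) * ∑ i, covariance (fun ω => F (Y ω) i) (fun ω => Y ω i) P

end

end MonoSpline

open MonoSpline

open Filter Topology

/-! Record the ties of `γhat y` as a setoid `s` on the indices, and let `W s` be the image under `B`
of the vectors constant on its classes. Perturbing the coefficients without breaking ties stays
feasible for small times of either sign, so the residual is orthogonal to `W s`
(`residual_dotProduct_eq_zero`). Hence the fit at `y` is the orthogonal projection of `y` onto `W
s`. Full column rank makes `B` injective, so this projection has trace `dim (W s)`, the number of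
classes, which is the number of distinct coefficients.

The fit is a projection onto a closed convex cone, hence Lipschitz and differentiable almost
everywhere by Rademacher. There are finitely many tie patterns, each on a measurable set, and almost
everywhere on such a set the derivative is the corresponding projection
(`ae_fderiv_eq_of_eq_on_pieces`); no description of the boundaries is needed. This gives
`ae_divergence_eq_numDistinct`. The law of `Y` is absolutely continuous, so the identity holds
almost surely, and Stein's lemma for Lipschitz maps turns the covariance into the expected
divergence. -/

/-! ### Integration by parts without compact support -/

/-- Integration by parts of a Lipschitz function against a `C¹` function, where compact support is
replaced by integrability. -/
theorem LipschitzWith.integral_lineDeriv_mul_eq_neg_of_integrable {E : Type*}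
    [NormedAddCommGroup E] [NormedSpace ℝ E] [FiniteDimensional ℝ E] [MeasurableSpace E]
    [BorelSpace E] {μ : Measure E} [μ.IsAddHaarMeasure] {C : ℝ≥0} {f g : E → ℝ}
    (hf : LipschitzWith C f) (hg : ContDiff ℝ 1 g) (v : E) (hg_int : Integrable g μ)
    (hfg : Integrable (fun x ↦ f x * g x) μ)
    (hfg' : Integrable (fun x ↦ f x * fderiv ℝ g x v) μ) :
    ∫ x, lineDeriv ℝ f x v * g x ∂μ = -∫ x, f x * fderiv ℝ g x v ∂μ := by
  -- The cutoffs `η k x = χ (x / (k + 1))` tend to `1`, and their derivatives tend to `0` under a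
  -- bound uniform in `k`. The compactly supported formula for `g * η k` then passes to the limit by
  -- dominated convergence.
  let χ : ContDiffBump (0 : E) := ⟨1, 2, one_pos, one_lt_two⟩
  let c : ℕ → ℝ := fun k ↦ ((k : ℝ) + 1)⁻¹
  have hc_pos : ∀ k, 0 < c k := fun k ↦ by positivity
  have hc_le : ∀ k, c k ≤ 1 := fun k ↦ inv_le_one_of_one_le₀ (by simp)
  have hc_lim : Tendsto c atTop (𝓝 0) := by
    simpa [c, one_div] using tendsto_one_div_add_atTop_nhds_zero_nat (𝕜 := ℝ)
  let η : ℕ → E → ℝ := fun k x ↦ χ (c k • x)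
  have hχ : ContDiff ℝ 1 χ := χ.contDiff
  have hη : ∀ k, ContDiff ℝ 1 (η k) := fun k ↦ hχ.comp (contDiff_const_smul _)
  have hη_supp : ∀ k, HasCompactSupport (η k) := fun k ↦
    χ.hasCompactSupport.comp_smul (hc_pos k).ne'
  have hη_fderiv : ∀ k x, fderiv ℝ (η k) x v = c k * fderiv ℝ χ (c k • x) v := fun k x ↦ by
    have h1 : HasFDerivAt (fun x : E ↦ c k • x) (c k • ContinuousLinearMap.id ℝ E) x :=
      (hasFDerivAt_id x).const_smul (c k)
    have h2 := ((hχ.differentiable one_ne_zero (c k • x)).hasFDerivAt).comp x h1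
    have h3 : fderiv ℝ (η k) x = _ := h2.fderiv
    rw [h3]
    simp
  obtain ⟨D, hD⟩ := ContDiff.lipschitzWith_of_hasCompactSupport χ.hasCompactSupport hχ one_ne_zero
  have hχ_bound : ∀ x, ‖fderiv ℝ χ x v‖ ≤ D * ‖v‖ := fun x ↦
    ((fderiv ℝ χ x).le_opNorm v).trans (by gcongr; exact norm_fderiv_le_of_lipschitz ℝ hD)
  have hη_le : ∀ k x, ‖η k x‖ ≤ 1 := fun k x ↦ by
    rw [Real.norm_eq_abs, abs_of_nonneg χ.nonneg]; exact χ.le_one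
  have hη_lim : ∀ x, Tendsto (fun k ↦ η k x) atTop (𝓝 1) := fun x ↦ by
    have h := (χ.continuous.tendsto 0).comp
      (by simpa using hc_lim.smul_const x : Tendsto (fun k ↦ c k • x) atTop (𝓝 0))
    have h0 : χ 0 = 1 := χ.one_of_mem_closedBall (by simp [χ])
    rwa [h0] at h
  have hη'_le : ∀ k x, ‖fderiv ℝ (η k) x v‖ ≤ D * ‖v‖ := fun k x ↦ by
    rw [hη_fderiv, norm_mul, Real.norm_of_nonneg (hc_pos k).le]
    exact (mul_le_of_le_one_left (norm_nonneg _) (hc_le k)).trans (hχ_bound _)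
  have hη'_lim : ∀ x, Tendsto (fun k ↦ fderiv ℝ (η k) x v) atTop (𝓝 0) := fun x ↦ by
    have h1 : Tendsto (fun k ↦ c k * (D * ‖v‖)) atTop (𝓝 0) := by
      simpa using hc_lim.mul_const (D * ‖v‖)
    refine squeeze_zero_norm (fun k ↦ ?_) h1
    rw [hη_fderiv, norm_mul, Real.norm_of_nonneg (hc_pos k).le]
    gcongr
    exact hχ_bound _
  have hparts : ∀ k, ∫ x, lineDeriv ℝ f x v * (g x * η k x) ∂μ
      = ∫ x, -(f x * fderiv ℝ g x v * η k x + f x * g x * fderiv ℝ (η k) x v) ∂μ := fun k ↦ by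
    have hgη : ContDiff ℝ 1 (fun x ↦ g x * η k x) := hg.mul (hη k)
    have hsupp : HasCompactSupport (fun x ↦ g x * η k x) := (hη_supp k).mul_left
    obtain ⟨D', hD'⟩ := ContDiff.lipschitzWith_of_hasCompactSupport hsupp hgη one_ne_zero
    rw [integral_lineDeriv_mul_eq hf hD' hsupp]
    congr 1
    ext x
    have hgx := hg.differentiable one_ne_zero x
    have hηx := (hη k).differentiable one_ne_zero x
    rw [(hgx.fun_mul hηx).lineDeriv_eq_fderiv, fderiv_fun_mul hgx hηx]
    simp
    ring
  have hmeas : AEStronglyMeasurable (fun x ↦ lineDeriv ℝ f x v) μ :=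
    aestronglyMeasurable_lineDeriv hf.continuous μ
  have hleft : Tendsto (fun k ↦ ∫ x, lineDeriv ℝ f x v * (g x * η k x) ∂μ) atTop
      (𝓝 (∫ x, lineDeriv ℝ f x v * g x ∂μ)) := by
    refine tendsto_integral_of_dominated_convergence (fun x ↦ C * ‖v‖ * ‖g x‖) (fun k ↦ ?_)
      (hg_int.norm.const_mul _) (fun k ↦ .of_forall fun x ↦ ?_) (.of_forall fun x ↦ ?_)
    · exact hmeas.mul ((hg.continuous.mul (hη k).continuous).aestronglyMeasurable)
    · rw [norm_mul, norm_mul]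
      gcongr
      · exact norm_lineDeriv_le_of_lipschitz ℝ hf
      · exact mul_le_of_le_one_right (norm_nonneg _) (hη_le k x)
    · simpa using ((hη_lim x).const_mul (g x)).const_mul (lineDeriv ℝ f x v)
  have hright : Tendsto
      (fun k ↦ ∫ x, -(f x * fderiv ℝ g x v * η k x + f x * g x * fderiv ℝ (η k) x v) ∂μ) atTop
      (𝓝 (∫ x, -(f x * fderiv ℝ g x v) ∂μ)) := by
    have hη'_cont : ∀ k, Continuous (fun x ↦ fderiv ℝ (η k) x v) := fun k ↦
      ((hη k).continuous_fderiv one_ne_zero).clm_apply continuous_const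
    refine tendsto_integral_of_dominated_convergence
      (fun x ↦ ‖f x * fderiv ℝ g x v‖ + ‖f x * g x‖ * (D * ‖v‖)) (fun k ↦ ?_)
      (hfg'.norm.add (hfg.norm.mul_const _)) (fun k ↦ .of_forall fun x ↦ ?_)
      (.of_forall fun x ↦ ?_)
    · exact ((hfg'.1.mul (hη k).continuous.aestronglyMeasurable).add
        (hfg.1.mul (hη'_cont k).aestronglyMeasurable)).neg
    · rw [norm_neg]
      refine (norm_add_le _ _).trans (add_le_add ?_ ?_)
      · rw [norm_mul _ (η k x)]
        exact mul_le_of_le_one_right (norm_nonneg _) (hη_le k x)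
      · rw [norm_mul _ (fderiv ℝ (η k) x v)]
        gcongr
        exact hη'_le k x
    · simpa using (((hη_lim x).const_mul (f x * fderiv ℝ g x v)).add
        ((hη'_lim x).const_mul (f x * g x))).neg
  rw [← integral_neg]
  exact tendsto_nhds_unique (hleft.congr hparts) hright

/-! ### Product Gaussian measures and Stein's lemma -/

section Gaussian

variable {ι : Type*} [Fintype ι]

theorem integrable_prod_gaussianPDFReal (m : ι → ℝ) (v : ℝ≥0) :
    Integrable (fun y : ι → ℝ ↦ ∏ i, gaussianPDFReal (m i) v (y i)) :=
  Integrable.fintype_prod fun i ↦ integrable_gaussianPDFReal (m i) v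

/-- A product of nondegenerate Gaussian measures has the product of the densities as density. -/
theorem pi_gaussianReal_eq_withDensity (m : ι → ℝ) {v : ℝ≥0} (hv : v ≠ 0) :
    Measure.pi (fun i ↦ gaussianReal (m i) v)
      = volume.withDensity (fun y ↦ ENNReal.ofReal (∏ i, gaussianPDFReal (m i) v (y i))) := by
  refine (Measure.pi_eq fun s hs ↦ ?_)
  rw [withDensity_apply _ (MeasurableSet.univ_pi hs), ← ofReal_integral_eq_lintegral_ofReal
    (integrable_prod_gaussianPDFReal m v).integrableOn (.of_forall fun y ↦
      Finset.prod_nonneg fun i _ ↦ gaussianPDFReal_nonneg _ _ _), volume_pi,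
    Measure.restrict_pi_pi, integral_fintype_prod_eq_prod,
    ENNReal.ofReal_prod_of_nonneg fun i _ ↦
      integral_nonneg fun y ↦ gaussianPDFReal_nonneg _ _ _]
  exact Finset.prod_congr rfl fun i _ ↦ (gaussianReal_apply_eq_integral _ hv _).symm

theorem pi_gaussianReal_absolutelyContinuous (m : ι → ℝ) {v : ℝ≥0} (hv : v ≠ 0) :
    Measure.pi (fun i ↦ gaussianReal (m i) v) ≪ volume := by
  rw [pi_gaussianReal_eq_withDensity m hv]
  exact withDensity_absolutelyContinuous _ _

theorem measurable_prod_gaussianPDFReal (m : ι → ℝ) (v : ℝ≥0) :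
    Measurable (fun y : ι → ℝ ↦ ∏ i, gaussianPDFReal (m i) v (y i)) :=
  Finset.measurable_fun_prod _ fun i _ ↦
    (measurable_gaussianPDFReal (m i) v).comp (measurable_pi_apply i)

theorem integral_pi_gaussianReal (m : ι → ℝ) {v : ℝ≥0} (hv : v ≠ 0) (g : (ι → ℝ) → ℝ) :
    ∫ y, g y ∂Measure.pi (fun i ↦ gaussianReal (m i) v)
      = ∫ y, g y * ∏ i, gaussianPDFReal (m i) v (y i) := by
  rw [pi_gaussianReal_eq_withDensity m hv, integral_withDensity_eq_integral_toReal_smul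
    (measurable_prod_gaussianPDFReal m v).ennreal_ofReal (by simp)]
  congr 1 with y
  rw [ENNReal.toReal_ofReal (Finset.prod_nonneg fun i _ ↦ gaussianPDFReal_nonneg _ _ _),
    smul_eq_mul, mul_comm]

theorem integrable_pi_gaussianReal_iff (m : ι → ℝ) {v : ℝ≥0} (hv : v ≠ 0) {g : (ι → ℝ) → ℝ} :
    Integrable g (Measure.pi fun i ↦ gaussianReal (m i) v)
      ↔ Integrable (fun y ↦ g y * ∏ i, gaussianPDFReal (m i) v (y i)) := by
  rw [pi_gaussianReal_eq_withDensity m hv, integrable_withDensity_iff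
    (measurable_prod_gaussianPDFReal m v).ennreal_ofReal (by simp)]
  simp_rw [ENNReal.toReal_ofReal (Finset.prod_nonneg fun i _ ↦ gaussianPDFReal_nonneg _ _ _)]

theorem prod_gaussianPDFReal_eq (m : ι → ℝ) (v : ℝ≥0) (y : ι → ℝ) :
    ∏ i, gaussianPDFReal (m i) v (y i)
      = (√(2 * Real.pi * v))⁻¹ ^ Fintype.card ι
        * Real.exp (-(∑ i, (y i - m i) ^ 2) / (2 * v)) := by
  simp only [gaussianPDFReal, Finset.prod_mul_distrib, Finset.prod_const, Finset.card_univ,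
    ← Real.exp_sum]
  rw [← Finset.sum_div, Finset.sum_neg_distrib]

theorem contDiff_prod_gaussianPDFReal (m : ι → ℝ) (v : ℝ≥0) :
    ContDiff ℝ 1 (fun y : ι → ℝ ↦ ∏ i, gaussianPDFReal (m i) v (y i)) := by
  simp_rw [prod_gaussianPDFReal_eq]
  fun_prop

theorem fderiv_prod_gaussianPDFReal_single [DecidableEq ι] (m : ι → ℝ) {v : ℝ≥0} (hv : v ≠ 0)
    (y : ι → ℝ) (i : ι) :
    fderiv ℝ (fun y : ι → ℝ ↦ ∏ i, gaussianPDFReal (m i) v (y i)) y (Pi.single i 1)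
      = -((y i - m i) / v * ∏ i, gaussianPDFReal (m i) v (y i)) := by
  have hv' : (v : ℝ) ≠ 0 := by exact_mod_cast hv
  rw [← ((contDiff_prod_gaussianPDFReal m v).differentiable one_ne_zero y).lineDeriv_eq_fderiv]
  refine HasLineDerivAt.lineDeriv ?_
  have h1 : ∀ j, HasDerivAt (fun t : ℝ ↦ ((y + t • (Pi.single i 1 : ι → ℝ)) j - m j) ^ 2)
      (2 * (y j - m j) * (Pi.single i 1 : ι → ℝ) j) 0 := fun j ↦ by
    have : HasDerivAt (fun t : ℝ ↦ y j + t * (Pi.single i 1 : ι → ℝ) j - m j)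
        ((Pi.single i 1 : ι → ℝ) j) 0 := by
      simpa using (((hasDerivAt_id (0 : ℝ)).mul_const _).const_add (y j)).sub_const (m j)
    simpa using this.fun_pow 2
  have h2 := HasDerivAt.fun_sum fun j (_ : j ∈ Finset.univ) ↦ h1 j
  have h3 := ((h2.fun_neg.div_const (2 * (v : ℝ))).exp).const_mul
    ((√(2 * Real.pi * v))⁻¹ ^ Fintype.card ι)
  unfold HasLineDerivAt
  simp_rw [prod_gaussianPDFReal_eq]
  refine h3.congr_deriv ?_
  simp [Pi.single_apply]
  field_simp

theorem memLp_eval_pi_gaussianReal (m : ι → ℝ) (v : ℝ≥0) (i : ι) :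
    MemLp (fun y : ι → ℝ ↦ y i) 2 (Measure.pi fun i ↦ gaussianReal (m i) v) :=
  (memLp_id_gaussianReal 2).comp_measurePreserving
    (measurePreserving_eval (fun i ↦ gaussianReal (m i) v) i)

theorem LipschitzWith.memLp_pi_gaussianReal {C : ℝ≥0} {g : (ι → ℝ) → ℝ} (hg : LipschitzWith C g)
    (m : ι → ℝ) (v : ℝ≥0) : MemLp g 2 (Measure.pi fun i ↦ gaussianReal (m i) v) := by
  have h0 : LipschitzWith C (fun y ↦ g y - g 0) := by
    simpa using hg.sub (LipschitzWith.const (g 0))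
  have h := h0.comp_memLp (by simp)
    (MemLp.of_eval fun i ↦ memLp_eval_pi_gaussianReal m v i : MemLp (fun y : ι → ℝ ↦ y) 2 _)
  simpa [Function.comp_def, Pi.add_def] using h.add (memLp_const (g 0))

/-- **Stein's lemma** for Lipschitz functions of independent Gaussian variables. -/
theorem LipschitzWith.covariance_pi_gaussianReal [DecidableEq ι] {C : ℝ≥0} {g : (ι → ℝ) → ℝ}
    (hg : LipschitzWith C g) (m : ι → ℝ) {v : ℝ≥0} (hv : v ≠ 0) (i : ι) :
    cov[g, fun y ↦ y i; Measure.pi fun i ↦ gaussianReal (m i) v]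
      = v * ∫ y, fderiv ℝ g y (Pi.single i 1) ∂Measure.pi fun i ↦ gaussianReal (m i) v := by
  set μ : Measure (ι → ℝ) := Measure.pi fun i ↦ gaussianReal (m i) v with hμ
  have hv' : (v : ℝ) ≠ 0 := by exact_mod_cast hv
  have hg2 : MemLp g 2 μ := hg.memLp_pi_gaussianReal m v
  have hi2 : MemLp (fun y : ι → ℝ ↦ y i - m i) 2 μ :=
    (memLp_eval_pi_gaussianReal m v i).sub (memLp_const _)
  have hmean : ∫ y : ι → ℝ, y i ∂μ = m i := by
    rw [hμ, integral_eval, integral_id_gaussianReal]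
  have hmean' : ∫ y : ι → ℝ, (y i - m i) ∂μ = 0 := by
    rw [integral_sub ((memLp_eval_pi_gaussianReal m v i).integrable (by norm_num))
      (integrable_const _), hmean]
    simp
  have hprod : Integrable (fun y ↦ g y * (y i - m i)) μ := hg2.integrable_mul hi2
  have hcov : cov[g, fun y ↦ y i; μ] = ∫ y, g y * (y i - m i) ∂μ := by
    rw [covariance, hmean]
    simp_rw [sub_mul]
    rw [integral_sub hprod ((hi2.integrable (by norm_num)).const_mul _), integral_const_mul,
      hmean', mul_zero, sub_zero]
  have hlin : ∫ y, fderiv ℝ g y (Pi.single i 1) ∂μ = ∫ y, lineDeriv ℝ g y (Pi.single i 1) ∂μ := by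
    refine integral_congr_ae ?_
    filter_upwards [(pi_gaussianReal_absolutelyContinuous m hv).ae_le hg.ae_differentiableAt]
      with y hy
    exact hy.lineDeriv_eq_fderiv.symm
  -- Differentiating the Gaussian density produces the factor `-(y i - m i) / v`, so integration by
  -- parts against it gives the covariance up to `v`.
  have hfderiv : ∀ y : ι → ℝ,
      g y * fderiv ℝ (fun y : ι → ℝ ↦ ∏ i, gaussianPDFReal (m i) v (y i)) y (Pi.single i 1)
        = -(v : ℝ)⁻¹ * (g y * (y i - m i) * ∏ i, gaussianPDFReal (m i) v (y i)) := fun y ↦ by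
    rw [fderiv_prod_gaussianPDFReal_single m hv]
    ring
  have hprod' := (integrable_pi_gaussianReal_iff m hv).1 hprod
  rw [hcov, hlin, integral_pi_gaussianReal m hv, integral_pi_gaussianReal m hv,
    hg.integral_lineDeriv_mul_eq_neg_of_integrable (contDiff_prod_gaussianPDFReal m v) _
      (integrable_prod_gaussianPDFReal m v)
      ((integrable_pi_gaussianReal_iff m hv).1 (hg2.integrable (by norm_num)))
      (by simp_rw [hfderiv]; exact hprod'.const_mul _)]
  simp_rw [hfderiv]
  rw [integral_const_mul]
  field_simp

end Gaussian

theorem dotProduct_self_nonneg_real {n : ℕ} (u : Fin n → ℝ) : 0 ≤ u ⬝ᵥ u :=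
  Finset.sum_nonneg fun i _ ↦ mul_self_nonneg (u i)

/-! ### Orthogonal projections, their traces and tie patterns -/

section OrthogonalProjection

/-- `Fin n → ℝ` carries the sup norm, so the projection is built in `EuclideanSpace` and transported
back. -/
theorem Submodule.exists_isProj_dotProduct {n : ℕ} (W : Submodule ℝ (Fin n → ℝ)) :
    ∃ p : (Fin n → ℝ) →ₗ[ℝ] (Fin n → ℝ), LinearMap.IsProj W p ∧
      ∀ y, ∀ w ∈ W, (y - p y) ⬝ᵥ w = 0 := by
  let e : EuclideanSpace ℝ (Fin n) ≃ₗ[ℝ] (Fin n → ℝ) := WithLp.linearEquiv 2 ℝ (Fin n → ℝ)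
  let W' : Submodule ℝ (EuclideanSpace ℝ (Fin n)) := W.comap e.toLinearMap
  refine ⟨e.toLinearMap ∘ₗ W'.starProjection.toLinearMap ∘ₗ e.symm.toLinearMap,
    ⟨fun y ↦ W'.starProjection_apply_mem (e.symm y), fun y hy ↦ ?_⟩, fun y w hw ↦ ?_⟩
  · have : W'.starProjection (e.symm y) = e.symm y :=
      Submodule.starProjection_eq_self_iff.2 (by simpa [W'] using hy)
    simp [this]
  · have hw' : e.symm w ∈ W' := by simpa [W'] using hw
    have h := Submodule.inner_left_of_mem_orthogonal hw'
      (Submodule.sub_starProjection_mem_orthogonal (K := W') (e.symm y))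
    rw [EuclideanSpace.inner_eq_star_dotProduct] at h
    rw [dotProduct_comm]
    simpa [e] using h

theorem LinearMap.IsProj.sum_apply_single {n : ℕ} {W : Submodule ℝ (Fin n → ℝ)}
    {p : (Fin n → ℝ) →ₗ[ℝ] (Fin n → ℝ)} (hp : LinearMap.IsProj W p) :
    ∑ i, p (Pi.single i 1) i = Module.finrank ℝ W := by
  rw [← hp.trace, LinearMap.trace_eq_matrix_trace ℝ (Pi.basisFun ℝ (Fin n)), Matrix.trace]
  simp

end OrthogonalProjection

section FunLeft

variable {ι : Type*} [Fintype ι]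

/-- The range consists of the images of vectors constant on the classes of `s`: one free coefficient
per class, and `b` loses none. -/
theorem finrank_range_comp_funLeft_mk {n : ℕ} {b : (ι → ℝ) →ₗ[ℝ] (Fin n → ℝ)}
    (hb : Function.Injective b) (s : Setoid ι) :
    Module.finrank ℝ (LinearMap.range (b ∘ₗ LinearMap.funLeft ℝ ℝ (Quotient.mk s)))
      = Nat.card (Quotient s) := by
  classical
  rw [LinearMap.finrank_range_of_inj
    (f := b ∘ₗ LinearMap.funLeft ℝ ℝ (Quotient.mk s)) (hb.comp (LinearMap.funLeft_injective_of_surjective ℝ ℝ _ Quotient.mk_surjective)),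
    Module.finrank_fintype_fun_eq_card, Nat.card_eq_fintype_card]

end FunLeft

theorem numDistinct_eq_card_quotient_ker {J : ℕ} (γ : Fin J → ℝ) :
    numDistinct γ = Nat.card (Quotient (Setoid.ker γ)) :=
  (Nat.card_congr (Setoid.quotientKerEquivRange γ)).symm

/-! ### Derivatives of piecewise linear maps -/

section Derivative

/-- If a map agrees with finitely many linear maps on pieces of a measurable partition, its
derivative agrees almost everywhere with those linear maps. -/
theorem ae_fderiv_eq_of_eq_on_pieces {E κ : Type*} [NormedAddCommGroup E] [NormedSpace ℝ E]
    [FiniteDimensional ℝ E] [MeasurableSpace E] [BorelSpace E] (μ : Measure E)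
    [μ.IsAddHaarMeasure] [Countable κ] {F : E → E} (hF : ∀ᵐ y ∂μ, DifferentiableAt ℝ F y)
    (c : E → κ) (hc : ∀ k, MeasurableSet (c ⁻¹' {k})) (A : κ → E →L[ℝ] E)
    (hA : ∀ y, F y = A (c y) y) : ∀ᵐ y ∂μ, fderiv ℝ F y = A (c y) := by
  have hk : ∀ k, ∀ᵐ y ∂μ, c y = k → DifferentiableAt ℝ F y → fderiv ℝ F y = A k := fun k ↦ by
    have hmeas : MeasurableSet (c ⁻¹' {k} ∩ {y | DifferentiableAt ℝ F y}) :=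
      (hc k).inter (measurableSet_of_differentiableAt ℝ F)
    -- On the piece `F` equals `A k` exactly, so the approximation constant is `0`. At almost every
    -- point of the piece (its density points) this forces the derivative to be `A k`.
    have happrox : ApproximatesLinearOn F (A k) (c ⁻¹' {k} ∩ {y | DifferentiableAt ℝ F y}) 0 := by
      rintro y ⟨hy, -⟩ z ⟨hz, -⟩
      rw [Set.mem_preimage, Set.mem_singleton_iff] at hy hz
      simp [hA y, hA z, hy, hz]
    have h := happrox.norm_fderiv_sub_le μ hmeas (fderiv ℝ F)
      fun y hy ↦ hy.2.hasFDerivAt.hasFDerivWithinAt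
    rw [ae_restrict_iff' hmeas] at h
    filter_upwards [h] with y hy h1 h2
    exact sub_eq_zero.1 (nnnorm_eq_zero.1 (nonpos_iff_eq_zero.1 (hy ⟨h1, h2⟩)))
  filter_upwards [ae_all_iff.2 hk, hF] with y hy hd
  exact hy _ rfl hd

end Derivative

/-! ### Least squares over monotone coefficients -/

section LeastSquares

variable {n m : ℕ} {α : ℝ} {B : Matrix (Fin n) (Fin (m + 1)) ℝ}

theorem diffMatrix_mulVec_apply (γ : Fin (m + 1) → ℝ) (i : Fin m) :
    (diffMatrix m *ᵥ γ) i = γ i.castSucc - γ i.succ := by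
  have hne : i.succ ≠ i.castSucc := (Fin.castSucc_lt_succ (i := i)).ne'
  have : ∀ j, diffMatrix m i j * γ j
      = (if j = i.castSucc then γ j else 0) - (if j = i.succ then γ j else 0) := fun j ↦ by
    simp only [diffMatrix, Matrix.of_apply]
    split_ifs with h1 h2 <;> simp_all
  simp [Matrix.mulVec, dotProduct, this]

/-- The variational inequality of a projection onto a convex set: moving from `γ` a fraction `t`
towards a feasible `β` cannot lower the objective. -/
theorem sub_dotProduct_le_zero_of_isMonotoneLSSolution {y : Fin n → ℝ} {γ : Fin (m + 1) → ℝ}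
    (h : IsMonotoneLSSolution α B y γ) {β : Fin (m + 1) → ℝ}
    (hβ : α • (diffMatrix m *ᵥ β) ≤ 0) :
    (y - B *ᵥ γ) ⬝ᵥ (B *ᵥ β - B *ᵥ γ) ≤ 0 := by
  set r := y - B *ᵥ γ with hr
  set d := B *ᵥ β - B *ᵥ γ with hd
  have hd0 := dotProduct_self_nonneg_real d
  have key : ∀ t : ℝ, 0 < t → t ≤ 1 → 2 * (r ⬝ᵥ d) ≤ t * (d ⬝ᵥ d) := fun t ht ht1 ↦ by
    have hfeas : α • (diffMatrix m *ᵥ ((1 - t) • γ + t • β)) ≤ 0 := by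
      rw [Matrix.mulVec_add, Matrix.mulVec_smul, Matrix.mulVec_smul, smul_add, smul_comm α,
        smul_comm α]
      exact add_nonpos (smul_nonpos_of_nonneg_of_nonpos (by linarith) h.1)
        (smul_nonpos_of_nonneg_of_nonpos ht.le hβ)
    have h1 := h.2 _ hfeas
    have h2 : y - B *ᵥ ((1 - t) • γ + t • β) = r - t • d := by
      rw [Matrix.mulVec_add, Matrix.mulVec_smul, Matrix.mulVec_smul, hr, hd]
      module
    rw [h2] at h1
    simp only [sub_dotProduct, dotProduct_sub, smul_dotProduct, dotProduct_smul, smul_eq_mul,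
      dotProduct_comm d r, ← hr] at h1
    have h3 : t * (2 * (r ⬝ᵥ d)) ≤ t * (t * (d ⬝ᵥ d)) := by linarith
    exact le_of_mul_le_mul_left h3 ht
  by_contra! hpos
  have hsum : 0 < r ⬝ᵥ d + d ⬝ᵥ d := by linarith
  -- For this `t` one has `t * (d ⬝ᵥ d) ≤ r ⬝ᵥ d`, against `2 * (r ⬝ᵥ d) ≤ t * (d ⬝ᵥ d)`. The
  -- denominator is positive even if `d = 0`.
  have h1 := key (r ⬝ᵥ d / (r ⬝ᵥ d + d ⬝ᵥ d)) (by positivity)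
    ((div_le_one hsum).2 (by linarith))
  have h2 : r ⬝ᵥ d / (r ⬝ᵥ d + d ⬝ᵥ d) * (d ⬝ᵥ d) ≤ r ⬝ᵥ d := by
    rw [div_mul_eq_mul_div, div_le_iff₀ hsum]
    nlinarith
  linarith

/-- With fits `u`, `w` at `y`, `z`, the two variational inequalities add up to `|u - w|² ≤ (y - z) ·
(u - w)`; expanding `|(u - w) - (y - z)|² ≥ 0` finishes. -/
theorem isMonotoneLSSolution_nonexpansive {y z : Fin n → ℝ} {γ β : Fin (m + 1) → ℝ}
    (hγ : IsMonotoneLSSolution α B y γ) (hβ : IsMonotoneLSSolution α B z β) :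
    (B *ᵥ γ - B *ᵥ β) ⬝ᵥ (B *ᵥ γ - B *ᵥ β) ≤ (y - z) ⬝ᵥ (y - z) := by
  have h1 := sub_dotProduct_le_zero_of_isMonotoneLSSolution hγ hβ.1
  have h2 := sub_dotProduct_le_zero_of_isMonotoneLSSolution hβ hγ.1
  have h3 := dotProduct_self_nonneg_real ((B *ᵥ γ - B *ᵥ β) - (y - z))
  simp only [sub_dotProduct, dotProduct_sub] at h1 h2 h3 ⊢
  simp only [dotProduct_comm _ (B *ᵥ γ), dotProduct_comm z y, dotProduct_comm z (B *ᵥ β),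
    dotProduct_comm y (B *ᵥ β)] at *
  linarith

theorem isMonotoneLSSolution_unique (hB : Function.Injective B.mulVec) {y : Fin n → ℝ}
    {γ β : Fin (m + 1) → ℝ} (hγ : IsMonotoneLSSolution α B y γ)
    (hβ : IsMonotoneLSSolution α B y β) : γ = β := by
  have h := isMonotoneLSSolution_nonexpansive hγ hβ
  rw [sub_self, zero_dotProduct] at h
  exact hB (sub_eq_zero.1
    (dotProduct_self_eq_zero.1 (le_antisymm h (dotProduct_self_nonneg_real _))))

/-- An injective linear map is a closed embedding, so the image of the feasible cone is closed and
convex and has a point nearest to `y`. -/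
theorem exists_isMonotoneLSSolution (hB : Function.Injective B.mulVec) (y : Fin n → ℝ) :
    ∃ γ, IsMonotoneLSSolution α B y γ := by
  let S : Set (Fin (m + 1) → ℝ) := {β | α • (diffMatrix m *ᵥ β) ≤ 0}
  let b : (Fin (m + 1) → ℝ) →ₗ[ℝ] EuclideanSpace ℝ (Fin n) :=
    (WithLp.linearEquiv 2 ℝ (Fin n → ℝ)).symm.toLinearMap ∘ₗ B.mulVecLin
  have hb : Function.Injective b :=
    (WithLp.linearEquiv 2 ℝ (Fin n → ℝ)).symm.injective.comp hB
  have hS_closed : IsClosed S := isClosed_le (by fun_prop) continuous_const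
  have hS_convex : Convex ℝ S := fun β hβ δ hδ s t hs ht _ ↦ by
    change α • (diffMatrix m *ᵥ (s • β + t • δ)) ≤ 0
    rw [Matrix.mulVec_add, Matrix.mulVec_smul, Matrix.mulVec_smul, smul_add, smul_comm α,
      smul_comm α]
    exact add_nonpos (smul_nonpos_of_nonneg_of_nonpos hs hβ)
      (smul_nonpos_of_nonneg_of_nonpos ht hδ)
  have hclosed : IsClosed (b '' S) :=
    (LinearMap.isClosedEmbedding_of_injective (LinearMap.ker_eq_bot.2 hb)).isClosedMap _ hS_closed
  obtain ⟨-, ⟨γ, hγ, rfl⟩, hmin⟩ := exists_norm_eq_iInf_of_complete_convex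
    (K := b '' S) ⟨b 0, 0, by simp [S], rfl⟩ hclosed.isComplete (hS_convex.linear_image b)
    (WithLp.toLp 2 y)
  refine ⟨γ, hγ, fun β hβ ↦ ?_⟩
  have hle : ‖WithLp.toLp 2 y - b γ‖ ≤ ‖WithLp.toLp 2 y - b β‖ := by
    rw [hmin]
    exact ciInf_le ⟨0, by rintro - ⟨w, rfl⟩; exact norm_nonneg _⟩
      (⟨b β, β, hβ, rfl⟩ : b '' S)
  have hnorm : ∀ δ, ‖WithLp.toLp 2 y - b δ‖ ^ 2 = (y - B *ᵥ δ) ⬝ᵥ (y - B *ᵥ δ) := fun δ ↦ by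
    rw [EuclideanSpace.real_norm_sq_eq]
    simp [dotProduct, b, pow_two]
  rw [← hnorm, ← hnorm]
  gcongr

/-- Directions in which equal coefficients stay equal are orthogonal to the residual. -/
theorem residual_dotProduct_eq_zero {y : Fin n → ℝ} {γ : Fin (m + 1) → ℝ}
    (h : IsMonotoneLSSolution α B y γ) {β : Fin (m + 1) → ℝ}
    (hβ : ∀ i j, γ i = γ j → β i = β j) : (y - B *ᵥ γ) ⬝ᵥ (B *ᵥ β) = 0 := by
  -- Tied neighbours stay tied for every `t`; a strict constraint stays strict for small `t` by
  -- continuity.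
  have hfeas : ∀ᶠ t : ℝ in 𝓝 0, α • (diffMatrix m *ᵥ (γ + t • β)) ≤ 0 := by
    simp only [Pi.le_def, Pi.smul_apply, diffMatrix_mulVec_apply, Pi.add_apply, Pi.zero_apply,
      smul_eq_mul]
    refine eventually_all.2 fun i ↦ ?_
    have hi : α * (γ i.castSucc - γ i.succ) ≤ 0 := by
      simpa [diffMatrix_mulVec_apply] using h.1 i
    by_cases heq : γ i.castSucc = γ i.succ
    · exact .of_forall fun t ↦ by simp [heq, hβ _ _ heq]
    · rcases hi.eq_or_lt with h0 | hlt
      · rcases mul_eq_zero.1 h0 with rfl | h0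
        · simp
        · exact absurd (sub_eq_zero.1 h0) heq
      · have hcont : ContinuousAt (fun t : ℝ ↦
            α * (γ i.castSucc + t * β i.castSucc - (γ i.succ + t * β i.succ))) 0 := by fun_prop
        exact (hcont.eventually_lt continuousAt_const (by simpa using hlt)).mono fun t ht ↦ ht.le
  have hmul : ∀ᶠ t : ℝ in 𝓝 0, t * ((y - B *ᵥ γ) ⬝ᵥ (B *ᵥ β)) ≤ 0 := hfeas.mono fun t ht ↦ by
    have := sub_dotProduct_le_zero_of_isMonotoneLSSolution h ht
    rwa [Matrix.mulVec_add, Matrix.mulVec_smul, add_sub_cancel_left, dotProduct_smul,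
      smul_eq_mul] at this
  obtain ⟨δ, hδ, hball⟩ := Metric.eventually_nhds_iff.1 hmul
  -- Using `t` of both signs turns the inequality into an equality.
  have h1 := hball (y := δ / 2) (by simp [abs_of_pos hδ, hδ])
  have h2 := hball (y := -(δ / 2)) (by simp [abs_of_pos hδ, hδ])
  nlinarith

/-- Nonexpansiveness is Euclidean while the distance here is the sup distance; comparing them costs
a factor `√n`, rounded up to `n`. -/
theorem lipschitzWith_mulVec_of_isMonotoneLSSolution
    {γhat : (Fin n → ℝ) → (Fin (m + 1) → ℝ)} (h : ∀ y, IsMonotoneLSSolution α B y (γhat y)) :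
    LipschitzWith n (fun y ↦ B *ᵥ γhat y) := by
  refine LipschitzWith.of_dist_le_mul fun y z ↦ ?_
  refine (dist_pi_le_iff (by positivity)).2 fun i ↦ ?_
  rw [Real.dist_eq, NNReal.coe_natCast]
  refine abs_le_of_sq_le_sq ?_ (by positivity)
  have hexp := isMonotoneLSSolution_nonexpansive (h y) (h z)
  have h1 : ((B *ᵥ γhat y) i - (B *ᵥ γhat z) i) ^ 2
      ≤ (B *ᵥ γhat y - B *ᵥ γhat z) ⬝ᵥ (B *ᵥ γhat y - B *ᵥ γhat z) := by
    rw [pow_two]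
    exact Finset.single_le_sum (f := fun i ↦ (B *ᵥ γhat y - B *ᵥ γhat z) i
      * (B *ᵥ γhat y - B *ᵥ γhat z) i) (fun j _ ↦ mul_self_nonneg _) (Finset.mem_univ i)
  have h2 : (y - z) ⬝ᵥ (y - z) ≤ n * dist y z ^ 2 := by
    have : ∀ j ∈ Finset.univ, (y - z) j * (y - z) j ≤ dist y z ^ 2 := fun j _ ↦ by
      rw [← pow_two, ← sq_abs]
      gcongr
      exact dist_le_pi_dist y z j
    exact (Finset.sum_le_sum this).trans_eq (by simp)
  have hn : (n : ℝ) ≤ (n : ℝ) ^ 2 := by exact_mod_cast Nat.le_self_pow two_ne_zero n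
  nlinarith [sq_nonneg (dist y z)]

theorem continuous_of_isMonotoneLSSolution (hB : Function.Injective B.mulVec)
    {γhat : (Fin n → ℝ) → (Fin (m + 1) → ℝ)} (h : ∀ y, IsMonotoneLSSolution α B y (γhat y)) :
    Continuous γhat := by
  obtain ⟨l, hl⟩ := LinearMap.exists_leftInverse_of_injective B.mulVecLin
    (LinearMap.ker_eq_bot.2 hB)
  have : γhat = fun y ↦ l (B *ᵥ γhat y) := funext fun y ↦ (LinearMap.congr_fun hl (γhat y)).symm
  rw [this]
  exact l.continuous_of_finiteDimensional.comp
    (lipschitzWith_mulVec_of_isMonotoneLSSolution h).continuous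

/-- The divergence of the fit is almost everywhere the number of distinct coefficients. -/
theorem ae_divergence_eq_numDistinct (hB : Function.Injective B.mulVec)
    {γhat : (Fin n → ℝ) → (Fin (m + 1) → ℝ)} (h : ∀ y, IsMonotoneLSSolution α B y (γhat y)) :
    ∀ᵐ y, divergence (fun y ↦ B *ᵥ γhat y) y = numDistinct (γhat y) := by
  let W : Setoid (Fin (m + 1)) → Submodule ℝ (Fin n → ℝ) := fun s ↦
    LinearMap.range (B.mulVecLin ∘ₗ LinearMap.funLeft ℝ ℝ (Quotient.mk s))
  choose p hp hp_orth using fun s ↦ (W s).exists_isProj_dotProduct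
  let c : (Fin n → ℝ) → Setoid (Fin (m + 1)) := fun y ↦ Setoid.ker (γhat y)
  have hcont := continuous_of_isMonotoneLSSolution hB h
  have hcoord : ∀ i, Measurable fun y ↦ γhat y i := fun i ↦
    ((continuous_apply i).comp hcont).measurable
  -- A tie pattern is fixed by finitely many equalities and inequalities between continuous
  -- coordinates.
  have hc : ∀ s, MeasurableSet (c ⁻¹' {s}) := fun s ↦ by
    have : c ⁻¹' {s} = ⋂ i, ⋂ j, {y | γhat y i = γhat y j ↔ s i j} := by
      ext y
      simp [c, Setoid.ext_iff, Setoid.ker_def]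
    rw [this]
    refine MeasurableSet.iInter fun i ↦ MeasurableSet.iInter fun j ↦ ?_
    by_cases hs : s i j
    · simpa [hs] using measurableSet_eq_fun (hcoord i) (hcoord j)
    · simp only [hs, iff_false]
      exact (measurableSet_eq_fun (hcoord i) (hcoord j)).compl
  have hfit : ∀ y, B *ᵥ γhat y = p (c y) y := fun y ↦ by
    have hmem : B *ᵥ γhat y ∈ W (c y) :=
      ⟨Quotient.lift (γhat y) fun _ _ hij ↦ hij, by
        simp only [LinearMap.comp_apply, Matrix.mulVecLin_apply]; rfl⟩
    -- The projection and the fit both lie in `W (c y)` and both leave residuals orthogonal to their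
    -- difference, which is therefore orthogonal to itself.
    have hdiff : p (c y) y - B *ᵥ γhat y ∈ W (c y) := (W (c y)).sub_mem ((hp _).map_mem y) hmem
    have h1 := hp_orth (c y) y _ hdiff
    have h2 : (y - B *ᵥ γhat y) ⬝ᵥ (p (c y) y - B *ᵥ γhat y) = 0 := by
      obtain ⟨δ, hδ⟩ := hdiff
      rw [← hδ]
      refine residual_dotProduct_eq_zero (h y) fun i j hij ↦ ?_
      exact congrArg δ (Quotient.sound (s := c y) hij)
    have h3 : (p (c y) y - B *ᵥ γhat y) ⬝ᵥ (p (c y) y - B *ᵥ γhat y) = 0 := by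
      calc _ = (y - B *ᵥ γhat y) ⬝ᵥ (p (c y) y - B *ᵥ γhat y)
            - (y - p (c y) y) ⬝ᵥ (p (c y) y - B *ᵥ γhat y) := by
            rw [← sub_dotProduct, sub_sub_sub_cancel_left]
        _ = 0 := by rw [h1, h2, sub_zero]
    exact (sub_eq_zero.1 (dotProduct_self_eq_zero.1 h3)).symm
  have : Finite (Setoid (Fin (m + 1))) :=
    Finite.of_injective (fun s i j ↦ s i j) fun s t hst ↦ Setoid.ext fun i j ↦
      iff_of_eq (congrFun (congrFun hst i) j)
  filter_upwards [ae_fderiv_eq_of_eq_on_pieces volume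
    (lipschitzWith_mulVec_of_isMonotoneLSSolution h).ae_differentiableAt c hc
    (fun s ↦ (p s).toContinuousLinearMap) hfit] with y hy
  rw [divergence, hy, numDistinct_eq_card_quotient_ker]
  simp only [LinearMap.coe_toContinuousLinearMap']
  rw [(hp (c y)).sum_apply_single]
  exact_mod_cast finrank_range_comp_funLeft_mk (b := B.mulVecLin) hB (c y)

end LeastSquares

/-! ### Law of the data, Stein's identity and the conclusion -/

theorem Matrix.mulVec_injective_of_rank_eq {n k : ℕ} {B : Matrix (Fin n) (Fin k) ℝ}
    (hB : B.rank = k) : Function.Injective B.mulVec := by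
  have h := LinearMap.finrank_range_add_finrank_ker B.mulVecLin
  rw [← Matrix.rank, hB, Module.finrank_fin_fun, Nat.add_eq_left,
    Submodule.finrank_eq_zero] at h
  exact LinearMap.ker_eq_bot.1 h

theorem hasLaw_pi_gaussianReal_of_signal_add_noise {Ω ι : Type*} [Fintype ι] [MeasurableSpace Ω]
    {P : Measure Ω} [IsProbabilityMeasure P] {f : ι → ℝ} {v : ℝ≥0} {ε : ι → Ω → ℝ}
    (hε : ∀ i, HasLaw (ε i) (gaussianReal 0 v) P) (hindep : iIndepFun ε P) {Y : Ω → ι → ℝ}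
    (hY : ∀ ω i, Y ω i = f i + ε i ω) :
    HasLaw Y (Measure.pi fun i ↦ gaussianReal (f i) v) P := by
  have hlaw : ∀ i, HasLaw (fun ω ↦ f i + ε i ω) (gaussianReal (f i) v) P := fun i ↦ by
    simpa using gaussianReal_const_add (hε i) (f i)
  have hind : iIndepFun (fun i ω ↦ f i + ε i ω) P :=
    hindep.comp (fun i x ↦ f i + x) fun i ↦ measurable_const_add (f i)
  obtain rfl : Y = fun ω i ↦ f i + ε i ω := funext fun ω ↦ funext fun i ↦ hY ω i
  refine ⟨aemeasurable_pi_lambda _ fun i ↦ (hlaw i).aemeasurable, ?_⟩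
  rw [hind.map_fun_eq_pi_map fun i ↦ (hlaw i).aemeasurable]
  simp_rw [fun i ↦ (hlaw i).map_eq]

/-- **Stein's identity** for the degrees of freedom of a Lipschitz fit to Gaussian data. -/
theorem LipschitzWith.integral_divergence_pi_gaussianReal {n : ℕ} {C : ℝ≥0}
    {F : (Fin n → ℝ) → (Fin n → ℝ)} (hF : LipschitzWith C F) (f : Fin n → ℝ) {v : ℝ≥0}
    (hv : v ≠ 0) :
    Integrable (divergence F) (Measure.pi fun i ↦ gaussianReal (f i) v) ∧
    (1 / (v : ℝ)) * ∑ i, cov[fun y ↦ F y i, fun y ↦ y i; Measure.pi fun i ↦ gaussianReal (f i) v]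
      = ∫ y, divergence F y ∂Measure.pi fun i ↦ gaussianReal (f i) v := by
  set μ : Measure (Fin n → ℝ) := Measure.pi fun i ↦ gaussianReal (f i) v with hμ
  have hv' : (v : ℝ) ≠ 0 := by exact_mod_cast hv
  -- The derivative is bounded by the Lipschitz constant; where `F` is not differentiable `fderiv`
  -- is `0`, so the bound holds everywhere.
  have hint : ∀ i, Integrable (fun y ↦ fderiv ℝ F y (Pi.single i 1) i) μ := fun i ↦ by
    refine Integrable.of_bound (C := C * ‖(Pi.single i 1 : Fin n → ℝ)‖)
      ((measurable_pi_apply i).comp (measurable_fderiv_apply_const ℝ F _)).aestronglyMeasurable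
      (.of_forall fun y ↦ (norm_le_pi_norm _ i).trans ?_)
    exact ((fderiv ℝ F y).le_opNorm _).trans (by gcongr; exact norm_fderiv_le_of_lipschitz ℝ hF)
  have hF_i : ∀ i, LipschitzWith C (fun y ↦ F y i) := fun i ↦ by
    simpa [Function.comp_def] using (LipschitzWith.eval (α := fun _ : Fin n ↦ ℝ) i).comp hF
  refine ⟨integrable_finsetSum _ fun i _ ↦ hint i, ?_⟩
  unfold divergence
  rw [integral_finsetSum _ fun i _ ↦ hint i, Finset.mul_sum]
  refine Finset.sum_congr rfl fun i _ ↦ ?_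
  rw [(hF_i i).covariance_pi_gaussianReal f hv i, one_div, inv_mul_cancel_left₀ hv']
  refine integral_congr_ae ?_
  filter_upwards [(pi_gaussianReal_absolutelyContinuous f hv).ae_le hF.ae_differentiableAt]
    with y hy
  rw [fderiv_apply hy]
  rfl

theorem proposition2
    (K n : ℕ) (ξ : Fin (K + 2) → ℝ) (τ : ℕ → ℝ) (hτ : IsAugmentedKnots K 4 ξ τ)
    (x : Fin n → ℝ) (B : Matrix (Fin n) (Fin (K + 4)) ℝ) (hB : B = cubicBasisMatrix K τ x)
    (hrank : B.rank = K + 4)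
    (α : ℝ) (hα : α = 1 ∨ α = -1)
    {Ω : Type*} [MeasurableSpace Ω] (P : Measure Ω) [IsProbabilityMeasure P]
    (f : Fin n → ℝ) (σ : ℝ≥0) (hσ : 0 < σ)
    (ε : Fin n → Ω → ℝ) (hε : ∀ i, HasLaw (ε i) (gaussianReal 0 (σ ^ 2)) P)
    (hindep : iIndepFun ε P)
    (Y : Ω → Fin n → ℝ) (hY : ∀ ω i, Y ω i = f i + ε i ω) :
    (∀ y, ∃! γ, IsMonotoneLSSolution α B y γ) ∧
    ∀ γhat : (Fin n → ℝ) → (Fin (K + 4) → ℝ), (∀ y, IsMonotoneLSSolution α B y (γhat y)) →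
      -- all the expectations and derivatives below exist
      (∀ i, MemLp (fun ω => (B *ᵥ γhat (Y ω)) i) 2 P) ∧
      (∀ᵐ ω ∂P, DifferentiableAt ℝ (fun y => B *ᵥ γhat y) (Y ω)) ∧
      Integrable (fun ω => divergence (fun y => B *ᵥ γhat y) (Y ω)) P ∧
      Integrable (fun ω => (numDistinct (γhat (Y ω)) : ℝ)) P ∧
      -- degrees of freedom, as normalized covariance and as expected divergence
      degreesOfFreedom P σ (fun y => B *ᵥ γhat y) Y = ∫ ω, (numDistinct (γhat (Y ω)) : ℝ) ∂P ∧
      ∫ ω, divergence (fun y => B *ᵥ γhat y) (Y ω) ∂P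
        = ∫ ω, (numDistinct (γhat (Y ω)) : ℝ) ∂P := by
  have hinj : Function.Injective B.mulVec := Matrix.mulVec_injective_of_rank_eq hrank
  refine ⟨fun y ↦ ?_, fun γhat hγ ↦ ?_⟩
  · obtain ⟨γ, hγ⟩ := exists_isMonotoneLSSolution (α := α) hinj y
    exact ⟨γ, hγ, fun β hβ ↦ isMonotoneLSSolution_unique hinj hβ hγ⟩
  have hv : σ ^ 2 ≠ 0 := pow_ne_zero 2 hσ.ne'
  have hlaw := hasLaw_pi_gaussianReal_of_signal_add_noise hε hindep hY
  have hLip := lipschitzWith_mulVec_of_isMonotoneLSSolution hγ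
  have hLip_i : ∀ i, LipschitzWith n (fun y ↦ (B *ᵥ γhat y) i) := fun i ↦ by
    simpa [Function.comp_def] using (LipschitzWith.eval (α := fun _ : Fin n ↦ ℝ) i).comp hLip
  -- Lebesgue-almost-everywhere statements pass to `Y` because its law has a density.
  have hae : ∀ {p : (Fin n → ℝ) → Prop}, (∀ᵐ y, p y) → ∀ᵐ ω ∂P, p (Y ω) := fun h ↦
    ae_of_ae_map hlaw.aemeasurable
      (hlaw.map_eq ▸ (pi_gaussianReal_absolutelyContinuous f hv).ae_le h)
  have hdiv : (fun ω ↦ divergence (fun y ↦ B *ᵥ γhat y) (Y ω))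
      =ᵐ[P] fun ω ↦ (numDistinct (γhat (Y ω)) : ℝ) :=
    hae (ae_divergence_eq_numDistinct hinj hγ)
  obtain ⟨hdiv_int, hstein⟩ := hLip.integral_divergence_pi_gaussianReal f hv
  have hdiv_int' : Integrable (fun ω ↦ divergence (fun y ↦ B *ᵥ γhat y) (Y ω)) P :=
    (hlaw.map_eq.symm ▸ hdiv_int :
      Integrable (divergence fun y ↦ B *ᵥ γhat y) (P.map Y)).comp_aemeasurable hlaw.aemeasurable
  refine ⟨fun i ↦ ?_, hae hLip.ae_differentiableAt, hdiv_int', hdiv_int'.congr hdiv, ?_,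
    integral_congr_ae hdiv⟩
  · exact (hlaw.map_eq.symm ▸ (hLip_i i).memLp_pi_gaussianReal f (σ ^ 2) :
      MemLp (fun y ↦ (B *ᵥ γhat y) i) 2 (P.map Y)).comp_of_map hlaw.aemeasurable
  · rw [← integral_congr_ae hdiv]
    have h := hlaw.integral_comp hdiv_int.aestronglyMeasurable
    rw [Function.comp_def] at h
    rw [h, ← hstein, degreesOfFreedom, NNReal.coe_pow]
    congr 1
    exact Finset.sum_congr rfl fun i _ ↦ hlaw.covariance_fun_comp
      (f := fun y ↦ (B *ᵥ γhat y) i) (g := fun y ↦ y i)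
      (hLip_i i).continuous.aemeasurable (measurable_pi_apply i).aemeasurable
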